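/- For $n\ge 1$ let $B_n$ be the braid group on $n$ strands, $$B_n=\langle \sigma_1,\dots,\sigma_{n-1}\mid \sigma_i\sigma_j=\sigma_j\sigma_i \text{ if } |i-j|\ge 2,\ \ \sigma_i\sigma_j\sigma_i=\sigma_j\sigma_i\sigma_j \text{ if } |i-j|=1\rangle,$$ and let $K_n=[B_n,B_n]$ be its commutator subgroup. Let $n\ge 5$. Then for every integer $r$ with $2\le r\le n-1$, $K_n$ has no subgroup of index $r$. Moreover, every nontrivial homomorphism $\rho:K_n\to S_n$ into the symmetric group of degree $n$ is transitive, that is, $\rho(K_n)$ acts transitively on $\{1,\dots,n\}$. -/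

import Mathlib

/-- The defining relators of the braid group on `n` strands, in the free group on
`σ₁, …, σₙ₋₁` (indexed from `0` by `Fin (n - 1)`): `σᵢ σⱼ = σⱼ σᵢ` if `|i - j| ≥ 2`
and `σᵢ σⱼ σᵢ = σⱼ σᵢ σⱼ` if `|i - j| = 1`. -/
def braidRels (n : ℕ) : Set (FreeGroup (Fin (n - 1))) :=
  {w | ∃ i j : Fin (n - 1), 2 ≤ |((i : ℕ) : ℤ) - ((j : ℕ) : ℤ)| ∧
      w = (FreeGroup.of i * FreeGroup.of j) * (FreeGroup.of j * FreeGroup.of i)⁻¹} ∪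
  {w | ∃ i j : Fin (n - 1), |((i : ℕ) : ℤ) - ((j : ℕ) : ℤ)| = 1 ∧
      w = (FreeGroup.of i * FreeGroup.of j * FreeGroup.of i) *
        (FreeGroup.of j * FreeGroup.of i * FreeGroup.of j)⁻¹}

/-- The braid group `Bₙ` on `n` strands, by its Artin presentation. -/
abbrev BraidGroup (n : ℕ) : Type := PresentedGroup (braidRels n)

/-- `Kₙ`, the commutator subgroup `[Bₙ, Bₙ]` of the braid group. -/
abbrev braidCommutator (n : ℕ) : Subgroup (BraidGroup n) := commutator (BraidGroup n)

/-! Both claims reduce to one: for n ≥ 5 every homomorphism f : K_n → S_{n-1} is trivial. A proper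
subgroup of index r < n would give a nontrivial action on r points, and a nontrivial action on n
points has an orbit of size greater than 1, hence of size n.

The engine is a triviality criterion. The B_n-conjugates of σ_i σ_{i+1}⁻¹ generate K_n, since
killing this element makes all generators equal. When some σ_l commutes with it, conjugation by B_n
can be corrected by a power of σ_l to conjugation by K_n, so a homomorphism on K_n that kills σ_i
σ_{i+1}⁻¹ is trivial (`eq_one_of_map_braidDiff_eq_one`). The elements σ_i σ_l⁻¹ and σ_{i+1} σ_l⁻¹
are braided, so it is enough that their images commute. In particular K_n is perfect and all its
permutation images are even.

The main claim goes by induction in steps of 3. The copy of K_m on the last m strands of K_{m+3}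
commutes with σ_0 σ_1⁻¹. If that copy acts nontrivially on m + 2 points, then by induction it has an
orbit of size at least m, and an even permutation commuting with it must be 1. So either the copy or
σ_0 σ_1⁻¹ is killed, and the criterion applies.

The base cases are small groups. For n = 5, A_4 is solvable. For n = 6, centralizers in A_5 are so
small that the relations among the σ_i σ_0⁻¹ cannot hold nontrivially. For n = 7, braided elements
in the centralizer of a nontrivial element of A_6 fall into a p-group, where braided elements
coincide. -/

/-! ### Generators and the abelianization of the braid group. -/

/-- The standard generator of `BraidGroup n`, indexed from `0` by natural numbers;
it is `1` when the index is out of range. -/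
def braidGen (n i : ℕ) : BraidGroup n :=
  if h : i < n - 1 then PresentedGroup.of ⟨i, h⟩ else 1

theorem braidGen_of_lt {n i : ℕ} (h : i < n - 1) :
    braidGen n i = PresentedGroup.of (rels := braidRels n) ⟨i, h⟩ := by
  simp [braidGen, h]

theorem braidGen_commute (n : ℕ) {i j : ℕ} (hij : i + 2 ≤ j) :
    Commute (braidGen n i) (braidGen n j) := by
  by_cases hj : j < n - 1
  · have hi : i < n - 1 := by omega
    rw [braidGen_of_lt hi, braidGen_of_lt hj]
    have h : (FreeGroup.of (⟨i, hi⟩ : Fin (n - 1)) * FreeGroup.of ⟨j, hj⟩) *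
        (FreeGroup.of ⟨j, hj⟩ * FreeGroup.of ⟨i, hi⟩)⁻¹ ∈ braidRels n := by
      refine Or.inl ⟨⟨i, hi⟩, ⟨j, hj⟩, ?_, rfl⟩
      rw [abs_sub_comm]
      exact le_trans (by simp only; omega) (le_abs_self _)
    have := PresentedGroup.one_of_mem h
    rw [map_mul, map_inv, mul_inv_eq_one, map_mul, map_mul] at this
    exact this
  · simp [braidGen, hj]

theorem braidGen_commute' (n : ℕ) {i j : ℕ} (hij : i + 2 ≤ j) :
    Commute (braidGen n j) (braidGen n i) :=
  (braidGen_commute n hij).symm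

theorem braidGen_braid {n i : ℕ} (h : i + 1 < n - 1) :
    braidGen n i * braidGen n (i + 1) * braidGen n i =
      braidGen n (i + 1) * braidGen n i * braidGen n (i + 1) := by
  have hi : i < n - 1 := by omega
  rw [braidGen_of_lt hi, braidGen_of_lt h]
  have h' : (FreeGroup.of (⟨i, hi⟩ : Fin (n - 1)) * FreeGroup.of ⟨i + 1, h⟩ *
      FreeGroup.of ⟨i, hi⟩) *
      (FreeGroup.of ⟨i + 1, h⟩ * FreeGroup.of ⟨i, hi⟩ * FreeGroup.of ⟨i + 1, h⟩)⁻¹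
        ∈ braidRels n := by
    refine Or.inr ⟨⟨i, hi⟩, ⟨i + 1, h⟩, ?_, rfl⟩
    simp
  have := PresentedGroup.one_of_mem h'
  rw [map_mul, map_inv, mul_inv_eq_one] at this
  simp only [map_mul] at this
  exact this

theorem braidGen_induction {n : ℕ} (S : Subgroup (BraidGroup n))
    (hS : ∀ i, i < n - 1 → braidGen n i ∈ S) (g : BraidGroup n) : g ∈ S := by
  have h : (⊤ : Subgroup (BraidGroup n)) ≤ S := by
    rw [← PresentedGroup.closure_range_of (braidRels n), Subgroup.closure_le]
    rintro _ ⟨i, rfl⟩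
    have := hS i i.2
    rwa [braidGen_of_lt i.2] at this
  exact h trivial

theorem eq_of_braid_of_commute {G : Type*} [Group G] {x y : G} (h : x * y * x = y * x * y)
    (hc : Commute x y) : x = y := by
  have h1 : x * y * x = x * y * y := by rw [h, hc.eq]
  exact mul_left_cancel h1

/-- If a homomorphism identifies two adjacent generators, it identifies all of them. -/
theorem map_braidGen_eq_of_adjacent {n : ℕ} {G : Type*} [Group G] (φ : BraidGroup n →* G)
    {i : ℕ} (hi : i + 1 < n - 1) (h : φ (braidGen n i) = φ (braidGen n (i + 1))) :
    ∀ j, j < n - 1 → φ (braidGen n j) = φ (braidGen n i) := by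
  have braid : ∀ j, j + 1 < n - 1 → φ (braidGen n j) * φ (braidGen n (j + 1)) *
      φ (braidGen n j) = φ (braidGen n (j + 1)) * φ (braidGen n j) * φ (braidGen n (j + 1)) := by
    intro j hj
    simp only [← map_mul, braidGen_braid hj]
  have comm : ∀ j, Commute (φ (braidGen n j)) (φ (braidGen n (j + 2))) := fun j =>
    (braidGen_commute n le_rfl).map φ
  have up : ∀ j, i ≤ j → j + 1 < n - 1 → φ (braidGen n j) = φ (braidGen n (j + 1)) := by
    intro j hij
    induction j, hij using Nat.le_induction with
    | base => exact fun _ => h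
    | succ k hk ih =>
      intro hk'
      have := ih (by omega)
      refine eq_of_braid_of_commute (braid _ hk') ?_
      rw [← this]
      exact comm k
  have down : ∀ k, k ≤ i → φ (braidGen n (i - k)) = φ (braidGen n (i - k + 1)) := by
    intro k
    induction k with
    | zero => exact fun _ => h
    | succ k ih =>
      intro hk
      have h1 := ih (by omega)
      obtain ⟨l, hl⟩ : ∃ l, i - k = l + 1 := ⟨i - k - 1, by omega⟩
      have hl' : i - (k + 1) = l := by omega
      rw [hl] at h1
      rw [hl']
      refine eq_of_braid_of_commute (braid _ (by omega)) ?_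
      rw [h1]
      exact comm l
  have up' : ∀ j, i ≤ j → j < n - 1 → φ (braidGen n j) = φ (braidGen n i) := by
    intro j hij
    induction j, hij using Nat.le_induction with
    | base => exact fun _ => rfl
    | succ k hk ih => exact fun hk' => (up k hk hk').symm.trans (ih (by omega))
  have down' : ∀ k, k ≤ i → φ (braidGen n (i - k)) = φ (braidGen n i) := by
    intro k
    induction k with
    | zero => exact fun _ => rfl
    | succ k ih =>
      intro hk
      rw [down _ hk, ← ih (by omega)]
      congr 2
      omega
  intro j hj
  rcases le_total i j with hij | hij
  · exact up' j hij hj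
  · have := down' (i - j) (by omega)
    rwa [show i - (i - j) = j by omega] at this

/-- A homomorphism identifying all generators has cyclic range. -/
theorem exists_zpow_of_map_braidGen_eq {n : ℕ} {G : Type*} [Group G] (φ : BraidGroup n →* G)
    (x : G) (h : ∀ j, j < n - 1 → φ (braidGen n j) = x) (g : BraidGroup n) :
    ∃ m : ℤ, φ g = x ^ m := by
  have := braidGen_induction ((Subgroup.zpowers x).comap φ) (fun i hi => by
    rw [Subgroup.mem_comap, h i hi]
    exact Subgroup.mem_zpowers x) g
  obtain ⟨m, hm⟩ := this
  exact ⟨m, hm.symm⟩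

/-- Once two adjacent generators are identified the image is cyclic, so commutators die. -/
theorem braidCommutator_le_ker {n : ℕ} {G : Type*} [Group G] (φ : BraidGroup n →* G)
    {i : ℕ} (hi : i + 1 < n - 1) (h : φ (braidGen n i) = φ (braidGen n (i + 1))) :
    braidCommutator n ≤ φ.ker := by
  have hz := exists_zpow_of_map_braidGen_eq φ _ (map_braidGen_eq_of_adjacent φ hi h)
  rw [braidCommutator, commutator_def, Subgroup.commutator_le]
  intro a _ b _
  obtain ⟨k, hk⟩ := hz a
  obtain ⟨l, hl⟩ := hz b
  rw [MonoidHom.mem_ker, map_commutatorElement, hk, hl, commutatorElement_eq_one_iff_commute]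
  exact (Commute.refl _).zpow_zpow k l

theorem abelianization_braidGen {n i j : ℕ} (hi : i < n - 1) (hj : j < n - 1) :
    Abelianization.of (braidGen n i) = Abelianization.of (braidGen n j) := by
  rcases Nat.lt_or_ge 2 n with hn | hn
  · have h01 : Abelianization.of (braidGen n 0) = Abelianization.of (braidGen n (0 + 1)) := by
      refine eq_of_braid_of_commute ?_ (Commute.all _ _)
      simp only [← map_mul, braidGen_braid (show 0 + 1 < n - 1 by omega)]
    have := map_braidGen_eq_of_adjacent Abelianization.of (by omega) h01
    rw [this i hi, this j hj]
  -- For n ≤ 2 there is at most one generator.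
  · rw [show i = j by omega]

/-! ### Triviality criteria for homomorphisms on the commutator subgroup. -/

theorem mem_braidCommutator_iff {n : ℕ} {g : BraidGroup n} :
    g ∈ braidCommutator n ↔ Abelianization.of g = 1 := by
  rw [braidCommutator, ← Abelianization.ker_of, MonoidHom.mem_ker]

/-- The element `σᵢ σⱼ⁻¹` of the commutator subgroup. -/
def braidDiff {n i j : ℕ} (hi : i < n - 1) (hj : j < n - 1) : braidCommutator n :=
  ⟨braidGen n i * (braidGen n j)⁻¹, by
    rw [mem_braidCommutator_iff, map_mul, map_inv, abelianization_braidGen hi hj, mul_inv_cancel]⟩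

@[simp] theorem coe_braidDiff {n i j : ℕ} (hi : i < n - 1) (hj : j < n - 1) :
    (braidDiff hi hj : BraidGroup n) = braidGen n i * (braidGen n j)⁻¹ := rfl

/-- Conjugation by any braid agrees, on elements commuting with a fixed generator,
with conjugation by an element of the commutator subgroup. -/
theorem exists_conj_eq {n j : ℕ} (hj : j < n - 1) (g : BraidGroup n) :
    ∃ k : braidCommutator n, ∀ y : BraidGroup n, Commute y (braidGen n j) →
      (k : BraidGroup n) * y * (k : BraidGroup n)⁻¹ = g * y * g⁻¹ := by
  obtain ⟨m, hm⟩ := exists_zpow_of_map_braidGen_eq (Abelianization.of) _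
    (fun i hi => abelianization_braidGen hi hj) g
  -- The power m is the exponent of g in the abelianization: dividing by σ_j^m lands in K_n, and
  -- σ_j^m does not affect conjugation of y.
  refine ⟨⟨g * (braidGen n j ^ m)⁻¹, ?_⟩, fun y hy => ?_⟩
  · rw [mem_braidCommutator_iff, map_mul, map_inv, map_zpow, hm, mul_inv_cancel]
  · have := (hy.zpow_right m).eq
    simp only [mul_inv_rev, inv_inv]
    calc g * (braidGen n j ^ m)⁻¹ * y * (braidGen n j ^ m * g⁻¹)
        = g * ((braidGen n j ^ m)⁻¹ * (y * braidGen n j ^ m)) * g⁻¹ := by group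
      _ = g * y * g⁻¹ := by rw [this, inv_mul_cancel_left]

/-- A homomorphism from the commutator subgroup killing `σᵢ σᵢ₊₁⁻¹` is trivial, provided some
generator is far from both. -/
theorem eq_one_of_map_braidDiff_eq_one {n : ℕ} {H : Type*} [Group H]
    (f : braidCommutator n →* H) {i l : ℕ} (hi : i < n - 1) (hi' : i + 1 < n - 1)
    (hl : l < n - 1) (hil : l + 2 ≤ i ∨ i + 3 ≤ l) (h : f (braidDiff hi hi') = 1) : f = 1 := by
  have hcl : Commute (braidGen n i * (braidGen n (i + 1))⁻¹) (braidGen n l) := by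
    rcases hil with hil | hil
    · exact (braidGen_commute' n hil).mul_left (braidGen_commute' n (by omega)).inv_left
    · exact (braidGen_commute n (by omega)).mul_left (braidGen_commute n (by omega)).inv_left
  -- Every B_n-conjugate of σ_i σ_{i+1}⁻¹ is already a K_n-conjugate, hence lies in the kernel of f.
  have hle : Subgroup.normalClosure {braidGen n i * (braidGen n (i + 1))⁻¹} ≤
      f.ker.map (braidCommutator n).subtype := by
    rw [Subgroup.normalClosure, Subgroup.closure_le]
    intro y hy
    obtain ⟨x, hx, hxy⟩ := Group.mem_conjugatesOfSet_iff.1 hy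
    rw [Set.mem_singleton_iff] at hx
    obtain ⟨g, rfl⟩ := isConj_iff.1 hxy
    subst hx
    obtain ⟨k, hk⟩ := exists_conj_eq hl g
    refine ⟨k * braidDiff hi hi' * k⁻¹, ?_, ?_⟩
    · simp [MonoidHom.mem_ker, h]
    · simpa using hk _ hcl
  -- Modulo this normal closure adjacent generators agree, so the closure contains K_n.
  have h1 := braidCommutator_le_ker (QuotientGroup.mk'
    (Subgroup.normalClosure {braidGen n i * (braidGen n (i + 1))⁻¹})) hi' (by
      rw [← mul_inv_eq_one, ← map_inv, ← map_mul, ← MonoidHom.mem_ker, QuotientGroup.ker_mk']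
      exact Subgroup.subset_normalClosure rfl)
  rw [QuotientGroup.ker_mk'] at h1
  ext k
  obtain ⟨k', hk', hkk⟩ := hle (h1 k.2)
  rw [← Subtype.ext hkk]
  exact hk'

/-- The elements `σᵢ σₗ⁻¹` satisfy the braid relation for adjacent indices far from `l`. -/
theorem braidDiff_braid {n i l : ℕ} (hi : i < n - 1) (hi' : i + 1 < n - 1)
    (hl : l < n - 1) (hil : l + 2 ≤ i) :
    braidDiff hi hl * braidDiff hi' hl * braidDiff hi hl =
      braidDiff hi' hl * braidDiff hi hl * braidDiff hi' hl := by
  ext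
  have h1 : Commute (braidGen n l)⁻¹ (braidGen n i) := (braidGen_commute n hil).inv_left
  have h2 : Commute (braidGen n l)⁻¹ (braidGen n (i + 1)) :=
    (braidGen_commute n (by omega)).inv_left
  have h3 := braidGen_braid hi'
  simp only [Subgroup.coe_mul, coe_braidDiff]
  generalize (braidGen n l)⁻¹ = z at *
  generalize braidGen n i = x at *
  generalize braidGen n (i + 1) = y at *
  calc x * z * (y * z) * (x * z) = x * (z * y) * (z * x) * z := by group
    _ = x * y * (z * x) * z * z := by
      rw [h1.eq, h2.eq]; simp only [mul_assoc]; rw [← mul_assoc z x, h1.eq]; simp only [mul_assoc]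
    _ = x * y * x * (z * z * z) := by rw [h1.eq]; group
    _ = y * x * y * (z * z * z) := by rw [h3]
    _ = y * x * (z * y) * z * z := by rw [h2.eq]; group
    _ = y * (z * x) * (z * y) * z := by
      rw [h1.eq, h2.eq]; simp only [mul_assoc]; rw [← mul_assoc z y, h2.eq]; simp only [mul_assoc]
    _ = _ := by group

/-- Braided elements that commute are equal, so the quotient σ_i σ_{i+1}⁻¹ of the two elements is
killed. This is the form in which the criterion is used for the base cases. -/
theorem eq_one_of_map_commute {n : ℕ} {H : Type*} [Group H] (f : braidCommutator n →* H)
    {i l : ℕ} (hi : i < n - 1) (hi' : i + 1 < n - 1) (hl : l < n - 1) (hil : l + 2 ≤ i)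
    (h : Commute (f (braidDiff hi hl)) (f (braidDiff hi' hl))) : f = 1 := by
  refine eq_one_of_map_braidDiff_eq_one f hi hi' hl (Or.inl hil) ?_
  have h1 := eq_of_braid_of_commute
    (by simpa only [map_mul] using congrArg f (braidDiff_braid hi hi' hl hil)) h
  have h2 : braidDiff hi hi' = braidDiff hi hl * (braidDiff hi' hl)⁻¹ := by
    ext; simp
  rw [h2, map_mul, h1, map_inv, mul_inv_cancel]

theorem hom_to_commGroup_eq_one {n : ℕ} (hn : 5 ≤ n) {A : Type*} [CommGroup A]
    (f : braidCommutator n →* A) : f = 1 :=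
  eq_one_of_map_commute f (i := 2) (l := 0) (by omega) (by omega) (by omega) (by omega)
    (Commute.all _ _)

theorem commutator_braidCommutator {n : ℕ} (hn : 5 ≤ n) :
    commutator (braidCommutator n) = ⊤ := by
  rw [← Abelianization.ker_of, hom_to_commGroup_eq_one hn Abelianization.of]
  exact MonoidHom.ker_one

theorem sign_map_braidCommutator {n : ℕ} (hn : 5 ≤ n) {α : Type*} [Fintype α] [DecidableEq α]
    (f : braidCommutator n →* Equiv.Perm α) (k : braidCommutator n) :
    Equiv.Perm.sign (f k) = 1 :=
  DFunLike.congr_fun (hom_to_commGroup_eq_one hn (Equiv.Perm.sign.comp f)) k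

/-! ### Small finite groups, and the case n = 5. -/

/-- Even permutations of five points commuting with an even involution commute. -/
theorem perm_five_commute_of_commute_involution : ∀ p : Equiv.Perm (Fin 5),
    (p ≠ 1 ∧ p * p = 1 ∧ Equiv.Perm.sign p = 1) → ∀ x : Equiv.Perm (Fin 5),
    (p * x = x * p ∧ Equiv.Perm.sign x = 1) → ∀ y : Equiv.Perm (Fin 5),
    (p * y = y * p ∧ Equiv.Perm.sign y = 1) → x * y = y * x := by
  decide +kernel

/-- An even permutation of five points, not an involution, is self-centralizing in the
alternating group. -/
theorem perm_five_mem_powers_of_commute : ∀ a : Equiv.Perm (Fin 5),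
    (a * a ≠ 1 ∧ Equiv.Perm.sign a = 1) → ∀ c : Equiv.Perm (Fin 5),
    (a * c = c * a ∧ Equiv.Perm.sign c = 1) →
    c ∈ [1, a, a * a, a * a * a, a * a * a * a] := by
  decide +kernel

/-- Perfectness forces the image into A_4, then into its commutator subgroup, the abelian Klein
four-group. -/
theorem braidCommutator_five_hom_eq_one (f : braidCommutator 5 →* Equiv.Perm (Fin 4)) :
    f = 1 := by
  let f' : braidCommutator 5 →* alternatingGroup (Fin 4) :=
    f.codRestrict _ fun k => sign_map_braidCommutator le_rfl f k
  have h4 : Nat.card (Fin 4) = 4 := by simp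
  have hmem : ∀ k, f' k ∈ alternatingGroup.kleinFour (Fin 4) := by
    intro k
    rw [alternatingGroup.kleinFour_eq_commutator h4, ← Abelianization.ker_of, MonoidHom.mem_ker]
    exact DFunLike.congr_fun (hom_to_commGroup_eq_one le_rfl (Abelianization.of.comp f')) k
  have := alternatingGroup.kleinFour_isKleinFour h4
  have hcomm : ∀ k l, Commute (f k) (f l) := by
    intro k l
    have h := mul_comm_of_exponent_two (IsKleinFour.exponent_two
      (G := alternatingGroup.kleinFour (Fin 4))) ⟨f' k, hmem k⟩ ⟨f' l, hmem l⟩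
    exact congrArg (fun z : alternatingGroup.kleinFour (Fin 4) =>
      ((z : alternatingGroup (Fin 4)) : Equiv.Perm (Fin 4))) h
  exact eq_one_of_map_commute f (i := 2) (l := 0) (by omega) (by omega) (by omega) (by omega)
    (hcomm _ _)

/-- Braided elements of a nilpotent group are equal. -/
theorem eq_of_braid_of_isNilpotent {G : Type*} [Group G] [Group.IsNilpotent G] :
    ∀ x y : G, x * y * x = y * x * y → x = y := by
  refine Group.nilpotent_center_quotient_ind
    (P := fun G _ _ => ∀ x y : G, x * y * x = y * x * y → x = y) G ?_ ?_
  · intro G _ _ x y _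
    exact Subsingleton.elim _ _
  · intro G _ _ ih x y h
    have h1 := ih (x : G ⧸ Subgroup.center G) y (by exact_mod_cast congrArg _ h)
    -- By induction x⁻¹y is central, so x and y commute.
    rw [QuotientGroup.eq, Subgroup.mem_center_iff] at h1
    have h2 : Commute x y := by
      have h3 := h1 x
      rw [mul_inv_cancel_left, mul_assoc, eq_inv_mul_iff_mul_eq] at h3
      exact h3
    exact eq_of_braid_of_commute h h2

/-! ### Permutations commuting with a group action. -/

/-- If a group without proper subgroups of index less than `m` and with no abelian quotients acts
on fewer than `2 * m` points, then every point is fixed by the group or by any given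
permutation commuting with the action. -/
theorem fixed_or_fixed_of_commute {G Ω : Type*} [Group G] [MulAction G Ω] [Finite Ω] {m : ℕ}
    (hperf : commutator G = ⊤)
    (hidx : ∀ H : Subgroup G, H.index ≠ 0 → H.index < m → H = ⊤)
    (hcard : Nat.card Ω < 2 * m) (x : Equiv.Perm Ω) (hx : ∀ (g : G) (ω : Ω), x (g • ω) = g • x ω)
    (ω : Ω) : (∀ g : G, g • ω = ω) ∨ x ω = ω := by
  have hxz : ∀ (g : G) (k : ℤ) (ω : Ω), (x ^ k) (g • ω) = g • (x ^ k) ω := by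
    intro g k ω
    have hc : Commute x (MulAction.toPermHom G Ω g) := by
      ext ω; exact hx g ω
    exact DFunLike.congr_fun (hc.zpow_left k).eq ω
  -- T consists of the elements carrying ω into its own cycle under x; it contains the stabilizer S
  -- of ω.
  let T : Subgroup G :=
    { carrier := {g | ∃ k : ℤ, g • ω = (x ^ k) ω}
      one_mem' := ⟨0, by simp⟩
      mul_mem' := by
        rintro g h ⟨k, hk⟩ ⟨l, hl⟩
        refine ⟨l + k, ?_⟩
        rw [mul_smul, hl, ← hxz, hk, zpow_add, Equiv.Perm.mul_apply]
      inv_mem' := by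
        rintro g ⟨k, hk⟩
        refine ⟨-k, ?_⟩
        rw [inv_smul_eq_iff, ← hxz, hk, ← Equiv.Perm.mul_apply, ← zpow_add]
        simp }
  have hST : MulAction.stabilizer G ω ≤ T := by
    intro g hg
    exact ⟨0, by simpa using hg⟩
  have horb : ∀ ω : Ω, (MulAction.stabilizer G ω).index = (MulAction.orbit G ω).ncard :=
    fun ω => MulAction.index_stabilizer G ω
  have hpos : ∀ ω : Ω, (MulAction.stabilizer G ω).index ≠ 0 := by
    intro ω
    rw [horb]
    exact ((Set.ncard_pos (Set.toFinite _)).2 (MulAction.nonempty_orbit ω)).ne'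
  by_cases hfix : MulAction.stabilizer G ω = ⊤
  · exact Or.inl fun g => by
      have : g ∈ MulAction.stabilizer G ω := hfix ▸ Subgroup.mem_top g
      exact this
  have hS : m ≤ (MulAction.stabilizer G ω).index := by
    by_contra! hlt
    exact hfix (hidx _ (hpos ω) hlt)
  have hle : (MulAction.stabilizer G ω).index ≤ Nat.card Ω := by
    rw [horb]; exact Set.ncard_le_card _
  have hmul := Subgroup.relIndex_mul_index hST
  by_cases hT : T = ⊤
  -- If T is everything, any two elements of G act on ω through commuting powers of x, so the
  -- commutator subgroup, which is all of G, fixes ω.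
  · left
    have hcomm : commutator G ≤ MulAction.stabilizer G ω := by
      rw [commutator_def, Subgroup.commutator_le]
      intro g _ h _
      obtain ⟨k, hk⟩ : g ∈ T := hT ▸ Subgroup.mem_top g
      obtain ⟨l, hl⟩ : h ∈ T := hT ▸ Subgroup.mem_top h
      have h1 : (g * h) • ω = (h * g) • ω := by
        rw [mul_smul, mul_smul, hk, hl, ← hxz, ← hxz, hk, hl, ← Equiv.Perm.mul_apply,
          ← Equiv.Perm.mul_apply, ← zpow_add, ← zpow_add, add_comm]
      rw [MulAction.mem_stabilizer_iff, commutatorElement_def]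
      have h2 : g * h * g⁻¹ * h⁻¹ = g * h * (h * g)⁻¹ := by group
      have h3 : (g * h)⁻¹ • (g * h) • ω = (g * h)⁻¹ • (h * g) • ω := by rw [h1]
      have h4 : (h * g)⁻¹ ∈ T := hT ▸ Subgroup.mem_top _
      obtain ⟨j, hj⟩ := h4
      have h5 : (h * g) • (x ^ j) ω = ω := by rw [← hj, smul_inv_smul]
      rw [h2, mul_smul, hj, ← hxz, h1, hxz, h5]
    rw [hperf] at hcomm
    exact absurd (top_le_iff.1 hcomm) hfix
  right
  have hT0 : T.index ≠ 0 := fun h0 => hpos ω (by rw [← hmul, h0, mul_zero])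
  have hTm : m ≤ T.index := by
    by_contra! hlt
    exact hT (hidx _ hT0 hlt)
  -- Otherwise [G : S] = [T : S][G : T] ≥ 2m, more than the number of points. Hence S = T.
  have hrel : (MulAction.stabilizer G ω).relIndex T = 1 := by
    have h0 : (MulAction.stabilizer G ω).relIndex T ≠ 0 := fun h0 =>
      hpos ω (by rw [← hmul, h0, zero_mul])
    by_contra h1
    have : 2 * m ≤ (MulAction.stabilizer G ω).relIndex T * T.index :=
      Nat.mul_le_mul (by omega) hTm
    omega
  rw [Subgroup.relIndex_eq_one] at hrel
  by_cases hxo : x ω ∈ MulAction.orbit G ω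
  · obtain ⟨g, hg⟩ := hxo
    have hg' : g ∈ T := ⟨1, by simpa using hg⟩
    have := hrel hg'
    rw [MulAction.mem_stabilizer_iff] at this
    exact hg.symm.trans this
  -- If x moves ω off its orbit, the orbits of ω and x ω are disjoint, of equal size at least m:
  -- again too many points.
  · exfalso
    have hstab : MulAction.stabilizer G (x ω) = MulAction.stabilizer G ω := by
      ext g
      rw [MulAction.mem_stabilizer_iff, MulAction.mem_stabilizer_iff, ← hx]
      exact x.injective.eq_iff
    have hdisj : Disjoint (MulAction.orbit G ω) (MulAction.orbit G (x ω)) := by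
      rw [Set.disjoint_left]
      intro z hz hz'
      apply hxo
      rw [← MulAction.orbit_eq_iff] at hz hz'
      rw [← hz, hz']
      exact MulAction.mem_orbit_self _
    have h1 := Set.ncard_union_eq hdisj
    rw [← horb, ← horb, hstab] at h1
    have h2 := Set.ncard_le_card (MulAction.orbit G ω ∪ MulAction.orbit G (x ω))
    omega

/-- Under the same hypotheses, if the action is nontrivial and has at most `m + 2` points, then an
even permutation commuting with the action is trivial. -/
theorem eq_one_of_commute_of_even {G Ω : Type*} [Group G] [MulAction G Ω] [Fintype Ω]
    [DecidableEq Ω] {m : ℕ} (hm : 3 ≤ m) (hperf : commutator G = ⊤)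
    (hidx : ∀ H : Subgroup G, H.index ≠ 0 → H.index < m → H = ⊤)
    (hcard : Nat.card Ω ≤ m + 2) (x : Equiv.Perm Ω)
    (hx : ∀ (g : G) (ω : Ω), x (g • ω) = g • x ω) (hsign : Equiv.Perm.sign x = 1)
    {g₀ : G} {ω₀ : Ω} (h₀ : g₀ • ω₀ ≠ ω₀) : x = 1 := by
  -- The bound m + 2 < 2m is where m ≥ 3 enters.
  have hfix := fixed_or_fixed_of_commute hperf hidx (by omega) x hx
  have hS : m ≤ (MulAction.orbit G ω₀).ncard := by
    rw [← MulAction.index_stabilizer]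
    by_contra! hlt
    refine h₀ ?_
    have h1 := hidx (MulAction.stabilizer G ω₀) ?_ hlt
    · have : g₀ ∈ MulAction.stabilizer G ω₀ := h1 ▸ Subgroup.mem_top g₀
      exact this
    · rw [MulAction.index_stabilizer]
      exact ((Set.ncard_pos (Set.toFinite _)).2 (MulAction.nonempty_orbit ω₀)).ne'
  -- Points moved by x are fixed by G, whereas the orbit of ω₀ contains no fixed point.
  have hdisj : Disjoint (MulAction.orbit G ω₀) (x.support : Set Ω) := by
    rw [Set.disjoint_right]
    intro z hz hz'
    have h1 : ∀ g : G, g • z = z := (hfix z).resolve_right (by simpa using hz)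
    rw [MulAction.mem_orbit_symm] at hz'
    obtain ⟨g, hg⟩ := hz'
    have h2 : ω₀ = z := hg.symm.trans (h1 g)
    exact h₀ (h2 ▸ h1 g₀)
  have h1 := Set.ncard_union_eq hdisj
  have h2 := Set.ncard_le_card (MulAction.orbit G ω₀ ∪ (x.support : Set Ω))
  rw [Set.ncard_coe_finset] at h1
  by_contra hne
  -- At most m + 2 - m = 2 points are left for the support, so x ≠ 1 would be a transposition, which
  -- is odd.
  have h3 : x.support.card = 2 := by
    have := Equiv.Perm.two_le_card_support_of_ne_one hne
    omega
  rw [Equiv.Perm.card_support_eq_two] at h3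
  rw [h3.sign_eq] at hsign
  exact absurd hsign (by decide)

/-! ### Shifted braid groups and the inductive step. -/

/-- The homomorphism of braid groups shifting the generators by `s`. -/
def braidShift (m s : ℕ) : BraidGroup m →* BraidGroup (m + s) :=
  PresentedGroup.toGroup (rels := braidRels m)
    (f := fun i : Fin (m - 1) => braidGen (m + s) ((i : ℕ) + s)) (by
    intro r hr
    rcases hr with ⟨i, j, hij, rfl⟩ | ⟨i, j, hij, rfl⟩
    · rw [map_mul, map_inv, mul_inv_eq_one]
      simp only [map_mul, FreeGroup.lift_apply_of]
      rcases le_total (i : ℕ) j with h | h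
      · rw [abs_of_nonpos (by omega)] at hij
        exact braidGen_commute _ (by omega)
      · rw [abs_of_nonneg (by omega)] at hij
        exact braidGen_commute' _ (by omega)
    · rw [map_mul, map_inv, mul_inv_eq_one]
      simp only [map_mul, FreeGroup.lift_apply_of]
      have hi := i.2
      have hj := j.2
      rcases le_total (i : ℕ) j with h | h
      · rw [abs_of_nonpos (by omega)] at hij
        have : (j : ℕ) + s = i + s + 1 := by omega
        rw [this]
        exact braidGen_braid (by omega)
      · rw [abs_of_nonneg (by omega)] at hij
        have : (i : ℕ) + s = j + s + 1 := by omega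
        rw [this]
        exact (braidGen_braid (by omega)).symm)

theorem braidShift_braidGen (m s : ℕ) {i : ℕ} (hi : i < m - 1) :
    braidShift m s (braidGen m i) = braidGen (m + s) (i + s) := by
  rw [braidGen_of_lt hi]
  exact PresentedGroup.toGroup.of _

theorem braidShift_mem (m s : ℕ) {g : BraidGroup m} (hg : g ∈ braidCommutator m) :
    braidShift m s g ∈ braidCommutator (m + s) := by
  have h : (commutator (BraidGroup m)).map (braidShift m s) ≤
      commutator (BraidGroup (m + s)) := by
    rw [commutator_def, commutator_def, Subgroup.map_commutator]
    exact Subgroup.commutator_mono le_top le_top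
  exact h ⟨g, hg, rfl⟩

/-- The shift, restricted to commutator subgroups. -/
def braidCommutatorShift (m s : ℕ) : braidCommutator m →* braidCommutator (m + s) :=
  ((braidShift m s).comp (braidCommutator m).subtype).codRestrict _
    fun g => braidShift_mem m s g.2

theorem coe_braidCommutatorShift (m s : ℕ) (g : braidCommutator m) :
    (braidCommutatorShift m s g : BraidGroup (m + s)) = braidShift m s g := rfl

theorem braidGen_commute_braidShift (m : ℕ) {s j : ℕ} (hj : j + 2 ≤ s) (g : BraidGroup m) :
    Commute (braidGen (m + s) j) (braidShift m s g) := by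
  have := braidGen_induction ((Subgroup.centralizer {braidGen (m + s) j}).comap (braidShift m s))
    (fun i hi => by
      rw [Subgroup.mem_comap, Subgroup.mem_centralizer_singleton_iff, braidShift_braidGen m s hi]
      exact (braidGen_commute' _ (by omega))) g
  rw [Subgroup.mem_comap, Subgroup.mem_centralizer_singleton_iff] at this
  exact Commute.symm this

/-- If `Kₙ` acts trivially on `n - 1` points, it has no proper subgroup of index less than `n`. -/
theorem eq_top_of_index_lt {n : ℕ}
    (hmain : ∀ f : braidCommutator n →* Equiv.Perm (Fin (n - 1)), f = 1)
    (H : Subgroup (braidCommutator n)) (h0 : H.index ≠ 0) (hlt : H.index < n) : H = ⊤ := by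
  have : H.FiniteIndex := ⟨h0⟩
  -- The action on cosets is extended by the identity to n - 1 points.
  obtain ⟨e⟩ : Nonempty ((braidCommutator n ⧸ H) ↪ Fin (n - 1)) := by
    have : Fintype (braidCommutator n ⧸ H) := Fintype.ofFinite _
    refine Function.Embedding.nonempty_of_card_le ?_
    rw [← Nat.card_eq_fintype_card, ← Nat.card_eq_fintype_card, Nat.card_fin]
    change H.index ≤ n - 1
    omega
  have h1 := hmain ((Equiv.Perm.viaEmbeddingHom e).comp
    (MulAction.toPermHom (braidCommutator n) (braidCommutator n ⧸ H)))
  rw [eq_top_iff]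
  intro g _
  have h2 : MulAction.toPermHom (braidCommutator n) (braidCommutator n ⧸ H) g = 1 := by
    apply Equiv.Perm.viaEmbeddingHom_injective e
    rw [map_one]
    exact DFunLike.congr_fun h1 g
  have h3 := DFunLike.congr_fun h2 ((1 : braidCommutator n) : braidCommutator n ⧸ H)
  change ((g * 1 : braidCommutator n) : braidCommutator n ⧸ H) = ((1 : braidCommutator n)) at h3
  rw [mul_one, eq_comm, QuotientGroup.eq] at h3
  simpa using h3

/-- The shift is 3 because σ_0 and σ_1 must both commute with the copy of K_m, whose generators
start at σ_3; the m + 2 points are then just few enough for the centralizer lemma. -/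
theorem braidCommutator_hom_eq_one_add_three {m : ℕ} (hm : 5 ≤ m)
    (hmain : ∀ f : braidCommutator m →* Equiv.Perm (Fin (m - 1)), f = 1)
    (f : braidCommutator (m + 3) →* Equiv.Perm (Fin (m + 3 - 1))) : f = 1 := by
  let φ := f.comp (braidCommutatorShift m 3)
  let _ : MulAction (braidCommutator m) (Fin (m + 3 - 1)) := MulAction.compHom _ φ
  have hsmul : ∀ (g : braidCommutator m) (ω : Fin (m + 3 - 1)), g • ω = φ g ω := fun _ _ => rfl
  by_cases hφ : φ = 1
  · have h1 := DFunLike.congr_fun hφ (braidDiff (n := m) (i := 0) (j := 1) (by omega) (by omega))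
    refine eq_one_of_map_braidDiff_eq_one f (i := 3) (l := 0) (by omega) (by omega) (by omega)
      (by omega) ?_
    rw [MonoidHom.one_apply] at h1
    rw [← h1]
    change f _ = f _
    congr 1
    ext
    rw [coe_braidCommutatorShift, coe_braidDiff, coe_braidDiff, map_mul, map_inv,
      braidShift_braidGen m 3 (by omega), braidShift_braidGen m 3 (by omega)]
  · obtain ⟨g₀, hg₀⟩ : ∃ g, φ g ≠ 1 := by
      by_contra! h
      exact hφ (MonoidHom.ext h)
    obtain ⟨ω₀, hω₀⟩ : ∃ ω, φ g₀ ω ≠ ω := by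
      by_contra! h
      exact hg₀ (Equiv.ext h)
    refine eq_one_of_map_braidDiff_eq_one f (i := 0) (l := 3) (by omega) (by omega) (by omega)
      (by omega) ?_
    refine eq_one_of_commute_of_even (G := braidCommutator m) (m := m) (by omega)
      (commutator_braidCommutator hm) (eq_top_of_index_lt hmain) (by simp) _ ?_
      (sign_map_braidCommutator (by omega) f _) (g₀ := g₀) (ω₀ := ω₀) hω₀
    intro g ω
    have hc : Commute (braidDiff (n := m + 3) (i := 0) (j := 1) (by omega) (by omega))
        (braidCommutatorShift m 3 g) := by
      refine Subtype.ext ?_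
      exact (braidGen_commute_braidShift m (by omega) _).mul_left
        (braidGen_commute_braidShift m (by omega) _).inv_left
    exact DFunLike.congr_fun (hc.map f).eq ω

/-! ### The swapping braid, and the case n = 6. -/

theorem mul_eq_mul_of_braid {G : Type*} [Group G] {x y z : G} (hxy : x * y * x = y * x * y)
    (hyz : y * z * y = z * y * z) (hxz : Commute x z) :
    (y * x * z * y) * x = z * (y * x * z * y) := by
  calc (y * x * z * y) * x = y * (x * z) * y * x := by group
    _ = y * z * (x * y * x) := by rw [hxz.eq]; group
    _ = (y * z * y) * x * y := by rw [hxy]; group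
    _ = z * y * (z * x) * y := by rw [hyz]; group
    _ = z * (y * x * z * y) := by rw [← hxz.eq]; group

theorem mul_eq_mul_of_braid' {G : Type*} [Group G] {x y z : G} (hxy : x * y * x = y * x * y)
    (hyz : y * z * y = z * y * z) (hxz : Commute x z) :
    (y * x * z * y) * z = x * (y * x * z * y) := by
  have := mul_eq_mul_of_braid hyz.symm hxy.symm hxz.symm
  rwa [mul_assoc y z x, ← hxz.eq, ← mul_assoc] at this

/-- The braid `σᵢ₊₁ σᵢ σᵢ₊₂ σᵢ₊₁`, which exchanges `σᵢ` and `σᵢ₊₂` by conjugation. -/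
def braidSwap (n i : ℕ) : BraidGroup n :=
  braidGen n (i + 1) * braidGen n i * braidGen n (i + 2) * braidGen n (i + 1)

theorem braidSwap_conj {n i : ℕ} (h : i + 2 < n - 1) :
    braidSwap n i * braidGen n i * (braidSwap n i)⁻¹ = braidGen n (i + 2) := by
  rw [mul_inv_eq_iff_eq_mul]
  exact mul_eq_mul_of_braid (braidGen_braid (by omega)) (braidGen_braid h)
    (braidGen_commute n le_rfl)

theorem braidSwap_conj' {n i : ℕ} (h : i + 2 < n - 1) :
    braidSwap n i * braidGen n (i + 2) * (braidSwap n i)⁻¹ = braidGen n i := by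
  rw [mul_inv_eq_iff_eq_mul]
  exact mul_eq_mul_of_braid' (braidGen_braid (by omega)) (braidGen_braid h)
    (braidGen_commute n le_rfl)

theorem braidSwap_commute {n i j : ℕ} (h : j + 2 ≤ i ∨ i + 4 ≤ j) :
    braidSwap n i * braidGen n j * (braidSwap n i)⁻¹ = braidGen n j := by
  rw [mul_inv_eq_iff_eq_mul]
  rcases h with h | h
  · exact (((braidGen_commute' n (by omega)).mul_left (braidGen_commute' n (by omega))).mul_left
      (braidGen_commute' n (by omega))).mul_left (braidGen_commute' n (by omega))
  · exact (((braidGen_commute n (by omega)).mul_left (braidGen_commute n (by omega))).mul_left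
      (braidGen_commute n (by omega))).mul_left (braidGen_commute n (by omega))

theorem conj_mul_inv_eq {G : Type*} [Group G] {g x y x' y' : G} (hx : g * x * g⁻¹ = x')
    (hy : g * y * g⁻¹ = y') : g * (x * y⁻¹) * g⁻¹ = x' * y'⁻¹ := by
  subst hx hy
  group

/-- The two braid relations show that conjugating b twice by a⁻¹ gives b⁻¹. As a³ = 1, this says a b
a⁻¹ = b⁻¹; comparison with a b a⁻¹ = b⁻¹ a b yields a b = 1, and the braid relation becomes a = a⁻¹.
-/
theorem sq_eq_one_of_braid_inv {G : Type*} [Group G] {a b : G} (ha : a * a * a = 1)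
    (h : a * b * a = b * a * b) (h' : a⁻¹ * b * a⁻¹ = b * a⁻¹ * b) : a * a = 1 := by
  have hinv : a⁻¹ = a * a := by rw [inv_eq_iff_mul_eq_one, ← mul_assoc, ha]
  have h1 : a * b * a⁻¹ = b⁻¹ * a * b := by
    rw [mul_inv_eq_iff_eq_mul]
    calc a * b = b⁻¹ * (b * a * b) := by group
      _ = _ := by rw [← h]; group
  have h2 : a⁻¹ * b * a = b⁻¹ * a⁻¹ * b := by
    calc a⁻¹ * b * a = b⁻¹ * (b * a⁻¹ * b) * a := by group
      _ = _ := by rw [← h']; group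
  have h3 : a⁻¹ * b * a = a * b⁻¹ * a⁻¹ := by
    calc a⁻¹ * b * a = (b⁻¹ * a * b)⁻¹ := by rw [h2]; group
      _ = _ := by rw [← h1]; group
  have h4 : a * b * a⁻¹ = b⁻¹ := by
    calc a * b * a⁻¹ = a⁻¹ * a⁻¹ * b * (a⁻¹)⁻¹ * (a⁻¹)⁻¹ * (a * a * a)⁻¹ := by
          rw [ha, inv_one, mul_one, inv_inv]
          have : a⁻¹ * a⁻¹ = a := by rw [← mul_inv_rev, ← hinv, inv_inv]
          rw [this, hinv, ← mul_assoc]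
      _ = a⁻¹ * (a⁻¹ * b * a) * a := by rw [ha]; group
      _ = b⁻¹ := by rw [h3]; group
  have h5 : a * b = 1 := by
    have : b⁻¹ * (a * b) = b⁻¹ * 1 := by rw [mul_one, ← mul_assoc, ← h1, h4]
    exact mul_left_cancel this
  have h6 : b = a⁻¹ := (inv_eq_of_mul_eq_one_right h5).symm
  subst h6
  simpa [eq_inv_iff_mul_eq_one] using h

/-- Conjugation by suitable elements of K_6 inverts A and sends C to C A⁻¹, or exchanges A and C.
These relations clash with the centralizer of f A in A_5: a Klein four-group if f A is an
involution, otherwise generated by f A. -/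
theorem braidCommutator_six_hom_eq_one (f : braidCommutator 6 →* Equiv.Perm (Fin 5)) :
    f = 1 := by
  have hsign := sign_map_braidCommutator (by norm_num) f
  let A : braidCommutator 6 := braidDiff (i := 2) (j := 0) (by norm_num) (by norm_num)
  let B : braidCommutator 6 := braidDiff (i := 3) (j := 0) (by norm_num) (by norm_num)
  let C : braidCommutator 6 := braidDiff (i := 4) (j := 0) (by norm_num) (by norm_num)
  have hAB : A * B * A = B * A * B := braidDiff_braid _ _ _ (by norm_num)
  have hBC : B * C * B = C * B * C := braidDiff_braid _ _ _ (by norm_num)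
  have c20 : Commute (braidGen 6 2) (braidGen 6 0) := braidGen_commute' 6 (by norm_num)
  have c42 : Commute (braidGen 6 4) (braidGen 6 2) := braidGen_commute' 6 (by norm_num)
  have c40 : Commute (braidGen 6 4) (braidGen 6 0) := braidGen_commute' 6 (by norm_num)
  have hAC : Commute A C := Subtype.ext
    ((c42.symm.mul_right c20.inv_right).mul_left
      (c40.symm.mul_right (Commute.refl _).inv_right).inv_left)
  -- T acts as the exchange of σ_0 and σ_2 on braids commuting with σ_4, and S as that of σ_2 and
  -- σ_4 on braids commuting with σ_0.
  obtain ⟨T, hT⟩ := exists_conj_eq (n := 6) (j := 4) (by norm_num) (braidSwap 6 0)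
  obtain ⟨S, hS⟩ := exists_conj_eq (n := 6) (j := 0) (by norm_num) (braidSwap 6 2)
  have hTA : T * A * T⁻¹ = A⁻¹ := by
    refine Subtype.ext ((hT _ (c42.symm.mul_left c40.symm.inv_left)).trans ?_)
    rw [conj_mul_inv_eq (braidSwap_conj' (by norm_num)) (braidSwap_conj (by norm_num))]
    simp [A]
  have hTC : T * C * T⁻¹ = C * A⁻¹ := by
    refine Subtype.ext ((hT _ ((Commute.refl _).mul_left c40.symm.inv_left)).trans ?_)
    rw [conj_mul_inv_eq (braidSwap_commute (by norm_num)) (braidSwap_conj (by norm_num))]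
    simp [A, C]
  have hSA : S * A * S⁻¹ = C := by
    refine Subtype.ext ((hS _ (c20.mul_left (Commute.refl _).inv_left)).trans ?_)
    rw [conj_mul_inv_eq (braidSwap_conj (by norm_num)) (braidSwap_commute (by norm_num))]
    simp [C]
  have hSC : S * C * S⁻¹ = A := by
    refine Subtype.ext ((hS _ (c40.mul_left (Commute.refl _).inv_left)).trans ?_)
    rw [conj_mul_inv_eq (braidSwap_conj' (by norm_num)) (braidSwap_commute (by norm_num))]
    simp [A]
  have triv : Commute (f A) (f B) → f = 1 := fun h =>
    eq_one_of_map_commute f (i := 2) (l := 0) (by norm_num) (by norm_num) (by norm_num)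
      (by norm_num) h
  replace hAB := congrArg f hAB
  replace hBC := congrArg f hBC
  replace hAC := hAC.map f
  replace hTA := congrArg f hTA
  replace hTC := congrArg f hTC
  replace hSA := congrArg f hSA
  replace hSC := congrArg f hSC
  have sA := hsign A
  have sB := hsign B
  have sC := hsign C
  simp only [map_mul, map_inv] at hAB hBC hTA hTC hSA hSC
  generalize f A = a at *
  generalize f B = b at *
  generalize f C = c at *
  generalize f T = t at *
  generalize f S = s at *
  by_cases haa : a * a = 1
  · by_cases ha1 : a = 1
    · exact triv (ha1 ▸ Commute.one_left b)
    · exfalso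
      have hainv : a⁻¹ = a := inv_eq_of_mul_eq_one_right haa
      have hcc : c * c = 1 := by
        rw [← hSA]
        calc s * a * s⁻¹ * (s * a * s⁻¹) = s * (a * a) * s⁻¹ := by group
          _ = 1 := by rw [haa]; group
      have hbb : b * b = 1 := by
        have hb : b = (a * b) * a * (a * b)⁻¹ := by
          rw [eq_mul_inv_iff_mul_eq, ← mul_assoc, ← hAB]
        calc b * b = (a * b) * a * (a * b)⁻¹ * ((a * b) * a * (a * b)⁻¹) := by rw [← hb]
          _ = (a * b) * (a * a) * (a * b)⁻¹ := by group
          _ = 1 := by rw [haa]; group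
      -- If c = a⁻¹ = a, then t c t⁻¹ = c a⁻¹ reads a = 1.
      have hp : a * c ≠ 1 := by
        intro h
        have hca : c = a⁻¹ := (inv_eq_of_mul_eq_one_right h).symm
        rw [hca, ← mul_inv_rev, haa, inv_one, hainv, hTA, hainv] at hTC
        exact ha1 hTC
      have hpp : a * c * (a * c) = 1 := by
        calc a * c * (a * c) = a * (c * a) * c := by group
          _ = a * a * (c * c) := by rw [← hAC.eq]; group
          _ = 1 := by rw [haa, hcc, mul_one]
      -- The element q = b a c b exchanges a and c, so it centralizes the involution a c, as a does;
      -- hence q commutes with a, and a = c.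
      have hqa := mul_eq_mul_of_braid hAB hBC hAC
      have hqc := mul_eq_mul_of_braid' hAB hBC hAC
      have hsq : Equiv.Perm.sign (b * a * c * b) = 1 := by
        simp [sA, sB, sC]
      generalize b * a * c * b = q at *
      have h1 := perm_five_commute_of_commute_involution (a * c)
        ⟨hp, hpp, by simp [sA, sC]⟩ a ⟨by rw [mul_assoc, ← hAC.eq], sA⟩ q
        ⟨by rw [← mul_assoc, hqa, mul_assoc c, hqc, ← mul_assoc, hAC.eq], hsq⟩
      rw [hqa] at h1
      have hac : a = c := mul_right_cancel h1
      rw [← hac] at hp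
      exact hp haa
  · exfalso
    have hmem := perm_five_mem_powers_of_commute a ⟨haa, sA⟩ c ⟨hAC.eq, sC⟩
    -- Conjugation by t inverts a, hence every power of a. With t c t⁻¹ = c a⁻¹ this gives a = c²,
    -- and the exchange by s gives c = a².
    have htc : t * c * t⁻¹ = c⁻¹ := by
      have key : ∀ x y : Equiv.Perm (Fin 5), t * (x * y) * t⁻¹ = t * x * t⁻¹ * (t * y * t⁻¹) :=
        fun x y => by group
      simp only [List.mem_cons, List.not_mem_nil, or_false] at hmem
      rcases hmem with rfl | h | h | h | h
      · group
      all_goals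
        rw [h]
        simp only [key, hTA, mul_inv_rev, mul_assoc]
    have hcc : a = c * c := by
      rw [htc, eq_mul_inv_iff_mul_eq, inv_mul_eq_iff_eq_mul] at hTC
      exact hTC
    have hca : c = a * a := by
      calc c = s * a * s⁻¹ := hSA.symm
        _ = (s * c * s⁻¹) * (s * c * s⁻¹) := by
          rw [hcc]
          group
        _ = a * a := by rw [hSC]
    have ha3 : a * a * a = 1 := by
      have h1 : a * a * a * a = 1 * a := by
        rw [one_mul]
        nth_rw 5 [hcc]
        rw [hca]
        group
      exact mul_right_cancel h1
    have hc : c = a⁻¹ := by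
      rw [hca, eq_inv_iff_mul_eq_one, ha3]
    rw [hc] at hBC
    exact haa (sq_eq_one_of_braid_inv ha3 hAB hBC.symm)

/-! ### Braided elements in centralizers, and the case n = 7. -/

theorem eq_of_braid_of_card_eq_pow {G : Type*} [Group G] (H : Subgroup G) {p k : ℕ}
    (hp : p.Prime) (hH : Nat.card H = p ^ k) {x y : G} (hx : x ∈ H) (hy : y ∈ H)
    (h : x * y * x = y * x * y) : x = y := by
  have : Fact p.Prime := ⟨hp⟩
  have : Finite H := Nat.finite_of_card_ne_zero (by rw [hH]; exact pow_ne_zero _ hp.ne_zero)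
  have := (IsPGroup.of_card hH).isNilpotent
  have := eq_of_braid_of_isNilpotent (⟨x, hx⟩ : H) ⟨y, hy⟩ (Subtype.ext h)
  exact congrArg Subtype.val this

theorem mem_of_index_two_of_odd {G : Type*} [Group G] {H : Subgroup G} (hH : H.index = 2)
    {x : G} (hx : Odd (orderOf x)) : x ∈ H := by
  obtain ⟨k, hk⟩ := hx
  have h1 : x ^ 2 ∈ H := Subgroup.sq_mem_of_index_two hH x
  have h2 : (x ^ 2) ^ (k + 1) = x := by
    rw [← pow_mul, show 2 * (k + 1) = 2 * k + 1 + 1 by ring, ← hk, pow_succ, pow_orderOf_eq_one,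
      one_mul]
  rw [← h2]
  exact pow_mem h1 _

/-- A Sylow 3-subgroup has index 2, so it contains all elements of odd order, and it is nilpotent.
-/
theorem eq_of_braid_of_card_eq_eighteen {G : Type*} [Group G] (hG : Nat.card G = 18) {x y : G}
    (hx : Odd (orderOf x)) (hy : Odd (orderOf y)) (h : x * y * x = y * x * y) : x = y := by
  have : Finite G := Nat.finite_of_card_ne_zero (by omega)
  have : Fact (Nat.Prime 3) := ⟨Nat.prime_three⟩
  obtain ⟨K, hK⟩ := Sylow.exists_subgroup_card_pow_prime (G := G) 3 (n := 2)
    (by rw [hG]; norm_num)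
  have hidx : K.index = 2 := by
    have := K.card_mul_index
    rw [hK, hG] at this
    omega
  exact eq_of_braid_of_card_eq_pow K Nat.prime_three hK (mem_of_index_two_of_odd hidx hx)
    (mem_of_index_two_of_odd hidx hy) h

theorem nat_card_centralizer_of_cycleType_replicate {α : Type*} [Fintype α] [DecidableEq α]
    {z : Equiv.Perm α} {k p : ℕ} (h : z.cycleType = Multiset.replicate (k + 1) p) :
    Nat.card (Subgroup.centralizer {z}) =
      (Fintype.card α - (k + 1) * p).factorial * p ^ (k + 1) * (k + 1).factorial := by
  rw [Equiv.Perm.nat_card_centralizer, h]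
  have : (Multiset.replicate (k + 1) p).toFinset = {p} := by
    rw [Multiset.toFinset_replicate, if_neg (Nat.succ_ne_zero k)]
  rw [this, Finset.prod_singleton, Multiset.count_replicate_self, Multiset.sum_replicate,
    Multiset.prod_replicate, smul_eq_mul]

/-- Braided permutations commuting with a nontrivial even permutation of six points are equal. -/
theorem perm_six_eq_of_braid {a x y : Equiv.Perm (Fin 6)} (ha : a ≠ 1)
    (hsign : Equiv.Perm.sign a = 1) (hax : Commute a x) (hay : Commute a y)
    (hx : orderOf x = orderOf a) (hy : orderOf y = orderOf a)
    (h : x * y * x = y * x * y) : x = y := by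
  -- Passing to a power z of a of prime order p makes z a product of k + 1 disjoint p-cycles, whose
  -- centralizer has known order.
  have key : ∀ p, p.Prime → p ∣ orderOf a → ∃ z : Equiv.Perm (Fin 6), ∃ k,
      Equiv.Perm.sign z = 1 ∧ z.cycleType = Multiset.replicate (k + 1) p ∧ (k + 1) * p ≤ 6 ∧
      x ∈ Subgroup.centralizer {z} ∧ y ∈ Subgroup.centralizer {z} := by
    intro p hp hpa
    have hz : orderOf (a ^ (orderOf a / p)) = p := orderOf_pow_orderOf_div (orderOf_pos a).ne' hpa
    obtain ⟨k, hk⟩ := Equiv.Perm.cycleType_prime_order (σ := a ^ (orderOf a / p))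
      (by rwa [hz])
    rw [hz] at hk
    refine ⟨_, k, ?_, hk, ?_, ?_, ?_⟩
    · rw [map_pow, hsign, one_pow]
    · have h1 := Equiv.Perm.sum_cycleType_le (a ^ (orderOf a / p))
      rwa [hk, Multiset.sum_replicate, smul_eq_mul, Fintype.card_fin] at h1
    · rw [Subgroup.mem_centralizer_singleton_iff]
      exact (hax.pow_left _).symm.eq
    · rw [Subgroup.mem_centralizer_singleton_iff]
      exact (hay.pow_left _).symm.eq
  by_cases h2 : 2 ∣ orderOf a
  · obtain ⟨z, k, hz, hk, hle, hxz, hyz⟩ := key 2 Nat.prime_two h2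
    have hcard := nat_card_centralizer_of_cycleType_replicate hk
    rw [Equiv.Perm.sign_of_cycleType, hk] at hz
    have hk2 : k ≤ 2 := by omega
    interval_cases k
    -- One or three transpositions are odd; two have centralizer of order 2! · 2² · 2! = 2⁴.
    · exact absurd hz (by simp +decide)
    · exact eq_of_braid_of_card_eq_pow _ Nat.prime_two (k := 4)
        (hcard.trans (by simp +decide)) hxz hyz h
    · exact absurd hz (by simp +decide)
  · have hodd : Odd (orderOf a) := by rwa [← Nat.not_even_iff_odd, even_iff_two_dvd]
    have h1 : orderOf a ≠ 1 := by rwa [Ne, orderOf_eq_one_iff]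
    obtain ⟨p, hp, hpa⟩ := Nat.exists_prime_and_dvd h1
    obtain ⟨z, k, hz, hk, hle, hxz, hyz⟩ := key p hp hpa
    have hcard := nat_card_centralizer_of_cycleType_replicate hk
    have hp6 : p ≤ 6 := le_trans (Nat.le_mul_of_pos_left p (Nat.succ_pos k)) hle
    have three : Nat.card (Subgroup.centralizer {z}) = 18 → x = y := by
      intro h18
      have := eq_of_braid_of_card_eq_eighteen h18
        (x := ⟨x, hxz⟩) (y := ⟨y, hyz⟩) (by rw [Subgroup.orderOf_mk, hx]; exact hodd)
        (by rw [Subgroup.orderOf_mk, hy]; exact hodd) (Subtype.ext h)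
      exact congrArg Subtype.val this
    interval_cases p
    · exact absurd hp (by norm_num)
    · exact absurd hp (by norm_num)
    · exact absurd hpa h2
    · have hk1 : k ≤ 1 := by omega
      -- One or two 3-cycles both have centralizer of order 18: 3! · 3 and 3² · 2!.
      interval_cases k
      · exact three (hcard.trans (by simp +decide))
      · exact three (hcard.trans (by simp +decide))
    · exact absurd hp (by norm_num)
    · have hk1 : k = 0 := by omega
      subst hk1
      exact eq_of_braid_of_card_eq_pow _ Nat.prime_five (k := 1)
        (hcard.trans (by simp +decide)) hxz hyz h
    · exact absurd hp (by norm_num)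

theorem orderOf_eq_of_conj {G : Type*} [Group G] {g x y : G} (h : g * x * g⁻¹ = y) :
    orderOf y = orderOf x := by
  rw [← h, ← MulAut.conj_apply]
  exact MulEquiv.orderOf_eq _ x

/-- A commutes with the braided pair E, F, and all three are conjugate in K_7, so their images have
equal order. Hence f E = f F, unless f A = 1 already. -/
theorem braidCommutator_seven_hom_eq_one (f : braidCommutator 7 →* Equiv.Perm (Fin 6)) :
    f = 1 := by
  have hsign := sign_map_braidCommutator (by norm_num) f
  let A : braidCommutator 7 := braidDiff (i := 2) (j := 0) (by norm_num) (by norm_num)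
  let E : braidCommutator 7 := braidDiff (i := 4) (j := 0) (by norm_num) (by norm_num)
  let F : braidCommutator 7 := braidDiff (i := 5) (j := 0) (by norm_num) (by norm_num)
  have hEF : E * F * E = F * E * F := braidDiff_braid _ _ _ (by norm_num)
  have far : ∀ i j, j + 2 ≤ i → Commute (braidGen 7 i) (braidGen 7 j) := fun i j h =>
    braidGen_commute' 7 h
  have hA : ∀ i (hi : i < 7 - 1), 4 ≤ i →
      Commute A (braidDiff (j := 0) hi (by norm_num)) := fun i hi h => Subtype.ext
    (((far i 2 h).symm.mul_right (far 2 0 (by norm_num)).inv_right).mul_left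
      ((far i 0 (by omega)).symm.mul_right (Commute.refl _).inv_right).inv_left)
  obtain ⟨S, hS⟩ := exists_conj_eq (n := 7) (j := 0) (by norm_num) (braidSwap 7 2)
  have hSA : S * A * S⁻¹ = E := by
    refine Subtype.ext ((hS _ ((far 2 0 (by norm_num)).mul_left
      (Commute.refl _).inv_left)).trans ?_)
    rw [conj_mul_inv_eq (braidSwap_conj (by norm_num)) (braidSwap_commute (by norm_num))]
    simp [E]
  have hEF' : (E * F) * E * (E * F)⁻¹ = F := by
    rw [mul_inv_eq_iff_eq_mul, hEF, mul_assoc]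
  by_cases ha : f A = 1
  · exact eq_one_of_map_commute f (i := 2) (l := 0) (by norm_num) (by norm_num) (by norm_num)
      (by norm_num) (ha ▸ Commute.one_left _)
  · have oE : orderOf (f E) = orderOf (f A) :=
      orderOf_eq_of_conj (g := f S) (by rw [← hSA]; simp)
    have oF : orderOf (f F) = orderOf (f E) :=
      orderOf_eq_of_conj (g := f (E * F)) (by rw [← map_inv, ← map_mul, ← map_mul, hEF'])
    have hef := perm_six_eq_of_braid ha (hsign A) ((hA 4 (by norm_num) le_rfl).map f)
      ((hA 5 (by norm_num) (by norm_num)).map f) oE (oF.trans oE)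
      (by simpa only [map_mul] using congrArg f hEF)
    exact eq_one_of_map_commute f (i := 4) (l := 0) (by norm_num) (by norm_num) (by norm_num)
      (by norm_num) (by rw [hef]; exact Commute.refl _)

/-! ### Conclusion. -/

/-- The commutator subgroup of the braid group on `n ≥ 5` strands acts trivially on any set with
`n - 1` elements. -/
theorem braidCommutator_hom_eq_one (n : ℕ) (hn : 5 ≤ n)
    (f : braidCommutator n →* Equiv.Perm (Fin (n - 1))) : f = 1 := by
  induction n using Nat.strong_induction_on with
  | _ n ih =>
    obtain rfl | rfl | rfl | h : n = 5 ∨ n = 6 ∨ n = 7 ∨ 8 ≤ n := by omega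
    · exact braidCommutator_five_hom_eq_one f
    · exact braidCommutator_six_hom_eq_one f
    · exact braidCommutator_seven_hom_eq_one f
    · obtain ⟨m, rfl⟩ : ∃ m, n = m + 3 := ⟨n - 3, by omega⟩
      exact braidCommutator_hom_eq_one_add_three (by omega)
        (ih m (by omega) (by omega)) f

theorem proposition7 (n : ℕ) (hn : 5 ≤ n) :
    (∀ r : ℕ, 2 ≤ r → r ≤ n - 1 → ¬ ∃ H : Subgroup (braidCommutator n), H.index = r) ∧
    (∀ ρ : braidCommutator n →* Equiv.Perm (Fin n), ρ ≠ 1 →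
      MulAction.IsPretransitive ρ.range (Fin n)) := by
  have htop := eq_top_of_index_lt (braidCommutator_hom_eq_one n hn)
  refine ⟨?_, ?_⟩
  · rintro r h2 hr ⟨H, hH⟩
    have := htop H (by omega) (by omega)
    rw [this, Subgroup.index_top] at hH
    omega
  · intro ρ hρ
    let _ : MulAction (braidCommutator n) (Fin n) := MulAction.compHom _ ρ
    obtain ⟨g, ω, hg⟩ : ∃ g ω, ρ g ω ≠ ω := by
      by_contra! h
      exact hρ (MonoidHom.ext fun g => Equiv.ext (h g))
    -- An orbit with fewer than n points would have stabilizer of index less than n, hence all of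
    -- K_n, but ω is moved by g.
    have horb : MulAction.orbit (braidCommutator n) ω = Set.univ := by
      rw [Set.eq_univ_iff_ncard, Nat.card_fin]
      refine le_antisymm ((Set.ncard_le_card _).trans_eq (Nat.card_fin n)) ?_
      by_contra! hlt
      rw [← MulAction.index_stabilizer] at hlt
      have h1 := htop _ (by
        rw [MulAction.index_stabilizer]
        exact ((Set.ncard_pos (Set.toFinite _)).2 (MulAction.nonempty_orbit ω)).ne') hlt
      have h2 : g ∈ MulAction.stabilizer (braidCommutator n) ω := h1 ▸ Subgroup.mem_top g
      exact hg h2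
    have hex : ∀ z : Fin n, ∃ k, ρ k ω = z := fun z => by
      have : z ∈ MulAction.orbit (braidCommutator n) ω := horb ▸ Set.mem_univ z
      exact this
    refine ⟨fun y z => ?_⟩
    obtain ⟨k, rfl⟩ := hex y
    obtain ⟨l, rfl⟩ := hex z
    refine ⟨⟨ρ (l * k⁻¹), l * k⁻¹, rfl⟩, ?_⟩
    change ρ (l * k⁻¹) (ρ k ω) = ρ l ω
    rw [← Equiv.Perm.mul_apply, ← map_mul, inv_mul_cancel_right]
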